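/- Let $D$ be an integral domain with quotient field $K$, and let $\star$ be a semistar operation on $D$, i.e. a map $E\mapsto E^\star$ from the set of nonzero $D$-submodules of $K$ to itself such that, for all nonzero $x\in K$ and all $E,F$: $(xE)^\star=xE^\star$; $E\subseteq F$ implies $E^\star\subseteq F^\star$; $E\subseteq E^\star$ and $(E^\star)^\star=E^\star$. Let $\star_f$ be the associated semistar operation of finite type, $E^{\star_f}=\bigcup\{F^\star : F\subseteq E,\ F \text{ a nonzero finitely generated } D\text{-submodule of } K\}$. A quasi-$\star$-ideal of $D$ is a nonzero ideal $I$ of $D$ with $I=I^\star\cap D$; a quasi-$\star$-maximal ideal is a maximal element of the set of proper quasi-$\star$-ideals (such an ideal is prime); the same terms are used for $\star_f$. The domain $D$ is called - $\star$-Noetherian if it satisfies the ascending chain condition on quasi-$\star$-ideals; - a P$\star$MD if $(II^{-1})^{\star_f}=D^{\star_f}$ for each nonzero finitely generated ideal $I$ of $D$, where $I^{-1}=\{z\in K : zI\subseteq D\}$; - $\star$-Dedekind if it is $\star$-Noetherian and a P$\star$MD; - $\star$-almost Dedekind if $D_M$ is a rank-one discrete valuation domain for each quasi-$\star_f$-maximal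 ideal $M$ of $D$. Theorem. The following are equivalent: 1. $D$ is $\star$-Dedekind. 2. $D$ is $\star$-almost Dedekind and each nonzero element of $D$ is contained in only finitely many quasi-$\star_f$-maximal ideals of $D$. 3. $D$ is $\star$-Noetherian and $\star$-almost Dedekind. -/

import Mathlib

open scoped Pointwise

/-- A semistar operation on an integral domain `D` with quotient field `K`: a map `E ↦ E^⋆` on the
nonzero `D`-submodules of `K` such that, for nonzero `x` in `K`, `(xE)^⋆ = x E^⋆`; `E ⊆ F` implies
`E^⋆ ⊆ F^⋆`; `E ⊆ E^⋆`; and `(E^⋆)^⋆ = E^⋆`. By `le_star` the image of a nonzero submodule is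
nonzero. So that the map is total it is extended by `0 ↦ 0` (`star_bot`), in the only way that is
compatible with this normalization; the other axioms then hold for the zero submodule as well, so
no condition is lost or added on the nonzero submodules. -/
structure SemistarOperation (D : Type*) (K : Type*) [CommRing D] [Field K] [Algebra D K] where
  star : Submodule D K → Submodule D K
  star_bot : star ⊥ = ⊥
  star_smul : ∀ (x : K), x ≠ 0 → ∀ E : Submodule D K, star (x • E) = x • star E
  star_mono : ∀ E F : Submodule D K, E ≤ F → star E ≤ star F
  le_star : ∀ E : Submodule D K, E ≤ star E
  star_star : ∀ E : Submodule D K, star (star E) = star E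

namespace SemistarOperation

variable {D K : Type*} [CommRing D] [Field K] [Algebra D K]

/-- `E ↦ ⋃ {F^⋆ | F finitely generated, F ⊆ E}`. Allowing `F = 0` does not change the union,
because `0^⋆ = 0`. -/
def finTypeSubmodule (s : SemistarOperation D K) (E : Submodule D K) : Submodule D K where
  carrier := {x | ∃ F : Submodule D K, F.FG ∧ F ≤ E ∧ x ∈ s.star F}
  zero_mem' := ⟨⊥, Submodule.fg_bot, bot_le, zero_mem _⟩
  add_mem' := by
    rintro x y ⟨F, hF, hFE, hx⟩ ⟨G, hG, hGE, hy⟩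
    exact ⟨F ⊔ G, hF.sup hG, sup_le hFE hGE,
      add_mem (s.star_mono _ _ le_sup_left hx) (s.star_mono _ _ le_sup_right hy)⟩
  smul_mem' := by
    rintro d x ⟨F, hF, hFE, hx⟩
    exact ⟨F, hF, hFE, Submodule.smul_mem _ d hx⟩

theorem mem_finTypeSubmodule (s : SemistarOperation D K) {E : Submodule D K} {x : K} :
    x ∈ s.finTypeSubmodule E ↔ ∃ F : Submodule D K, F.FG ∧ F ≤ E ∧ x ∈ s.star F :=
  Iff.rfl

theorem exists_fg_of_le_finTypeSubmodule (s : SemistarOperation D K) {E G : Submodule D K}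
    (hG : G.FG) (h : G ≤ s.finTypeSubmodule E) :
    ∃ F : Submodule D K, F.FG ∧ F ≤ E ∧ G ≤ s.star F := by
  induction G, hG using Submodule.fg_induction with
  | singleton x =>
    obtain ⟨F, hF, hFE, hx⟩ := h (Submodule.mem_span_singleton_self x)
    exact ⟨F, hF, hFE, (Submodule.span_singleton_le_iff_mem _ _).2 hx⟩
  | sup A B _ _ hA hB =>
    obtain ⟨F, hF, hFE, h1⟩ := hA (le_sup_left.trans h)
    obtain ⟨F', hF', hFE', h2⟩ := hB (le_sup_right.trans h)
    exact ⟨F ⊔ F', hF.sup hF', sup_le hFE hFE',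
      sup_le (h1.trans (s.star_mono _ _ le_sup_left)) (h2.trans (s.star_mono _ _ le_sup_right))⟩

theorem finTypeSubmodule_smul_le (s : SemistarOperation D K) {x : K} (hx : x ≠ 0)
    (E : Submodule D K) : s.finTypeSubmodule (x • E) ≤ x • s.finTypeSubmodule E := by
  rintro y ⟨F, hF, hFE, hy⟩
  rw [Submodule.mem_smul_pointwise_iff_exists]
  have hF' : x⁻¹ • F ≤ E := by
    intro z hz
    obtain ⟨f, hf, rfl⟩ := (Submodule.mem_smul_pointwise_iff_exists _ _ _).1 hz
    obtain ⟨e, he, rfl⟩ := (Submodule.mem_smul_pointwise_iff_exists _ _ _).1 (hFE hf)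
    rwa [inv_smul_smul₀ hx]
  refine ⟨x⁻¹ • y, ⟨x⁻¹ • F, ?_, hF', ?_⟩, smul_inv_smul₀ hx y⟩
  · exact hF.map _
  · rw [s.star_smul _ (inv_ne_zero hx)]
    exact Submodule.smul_mem_pointwise_smul _ _ _ hy

/-- The semistar operation of finite type `⋆_f` associated to `⋆`:
`E^{⋆_f} = ⋃ {F^⋆ | F finitely generated, F ⊆ E}`. -/
def finType (s : SemistarOperation D K) : SemistarOperation D K where
  star := s.finTypeSubmodule
  star_bot := by
    rw [eq_bot_iff]
    rintro x ⟨F, -, hF, hx⟩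
    rw [le_bot_iff.1 hF, s.star_bot] at hx
    exact hx
  star_smul := by
    intro x hx E
    refine le_antisymm (s.finTypeSubmodule_smul_le hx E) ?_
    intro y hy
    obtain ⟨z, ⟨F, hF, hFE, hz⟩, rfl⟩ := (Submodule.mem_smul_pointwise_iff_exists _ _ _).1 hy
    refine ⟨x • F, hF.map _, ?_, ?_⟩
    · intro w hw
      obtain ⟨f, hf, rfl⟩ := (Submodule.mem_smul_pointwise_iff_exists _ _ _).1 hw
      exact Submodule.smul_mem_pointwise_smul _ _ _ (hFE hf)
    · rw [s.star_smul x hx]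
      exact Submodule.smul_mem_pointwise_smul _ _ _ hz
  star_mono := by
    rintro E E' h x ⟨F, hF, hFE, hx⟩
    exact ⟨F, hF, hFE.trans h, hx⟩
  le_star := by
    intro E x hx
    exact ⟨Submodule.span D {x}, Submodule.fg_span_singleton x,
      (Submodule.span_singleton_le_iff_mem _ _).2 hx,
      s.le_star _ (Submodule.mem_span_singleton_self x)⟩
  star_star := by
    intro E
    refine le_antisymm ?_ ?_
    · rintro x ⟨G, hG, hGE, hx⟩
      obtain ⟨F, hF, hFE, hGF⟩ := s.exists_fg_of_le_finTypeSubmodule hG hGE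
      refine ⟨F, hF, hFE, ?_⟩
      rw [← s.star_star F]
      exact s.star_mono _ _ hGF hx
    · intro x hx
      exact ⟨Submodule.span D {x}, Submodule.fg_span_singleton x,
        (Submodule.span_singleton_le_iff_mem _ _).2 hx,
        s.le_star _ (Submodule.mem_span_singleton_self x)⟩

/-- The ideal `I^⋆ ∩ D` of `D`, where `I` is seen as a submodule of `K`. -/
def contract (s : SemistarOperation D K) (I : Ideal D) : Ideal D :=
  Submodule.comap (Algebra.linearMap D K)
    (s.star (Submodule.map (Algebra.linearMap D K) I))

/-- A quasi-`⋆`-ideal: a nonzero ideal `I` of `D` with `I = I^⋆ ∩ D`. -/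
def IsQuasiIdeal (s : SemistarOperation D K) (I : Ideal D) : Prop :=
  I ≠ ⊥ ∧ I = s.contract I

/-- A quasi-`⋆`-maximal ideal: maximal among the proper quasi-`⋆`-ideals. -/
def IsQuasiMaximal (s : SemistarOperation D K) (M : Ideal D) : Prop :=
  Maximal (fun I : Ideal D => s.IsQuasiIdeal I ∧ I ≠ ⊤) M

/-- `E` is `⋆`-invertible: `(E E⁻¹)^⋆ = D^⋆`, where `E⁻¹ = (D :_K E)`. Here `1` is the submodule
`D` of `K` and `1 / E = {z ∈ K | z E ⊆ D}`. -/
def IsStarInvertible (s : SemistarOperation D K) (E : Submodule D K) : Prop :=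
  s.star (E * (1 / E)) = s.star 1

/-- `⋆`-Noetherian: the ascending chain condition on quasi-`⋆`-ideals. -/
def IsNoetherianDomain (s : SemistarOperation D K) : Prop :=
  WellFoundedGT {I : Ideal D // s.IsQuasiIdeal I}

/-- Prüfer `⋆`-multiplication domain: each nonzero finitely generated ideal of `D` is
`⋆_f`-invertible. -/
def IsPruferMultiplicationDomain (s : SemistarOperation D K) : Prop :=
  ∀ I : Ideal D, I ≠ ⊥ → I.FG →
    s.finType.IsStarInvertible (Submodule.map (Algebra.linearMap D K) I)

/-- `⋆`-Dedekind domain: a `⋆`-Noetherian Prüfer `⋆`-multiplication domain. -/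
def IsDedekind (s : SemistarOperation D K) : Prop :=
  s.IsNoetherianDomain ∧ s.IsPruferMultiplicationDomain

/-- `⋆`-finite character property: each nonzero element of `D` lies in only finitely many
quasi-`⋆`-maximal ideals. -/
def HasFiniteCharacter (s : SemistarOperation D K) : Prop :=
  ∀ x : D, x ≠ 0 → {M : Ideal D | s.IsQuasiMaximal M ∧ x ∈ M}.Finite

/-- Every quasi-`⋆`-maximal ideal is prime, so that one can localize at it. -/
theorem IsQuasiMaximal.isPrime [IsDomain D] [IsFractionRing D K] {s : SemistarOperation D K}
    {M : Ideal D} (hM : s.IsQuasiMaximal M) : M.IsPrime := by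
  obtain ⟨⟨⟨hM0, hMq⟩, hMtop⟩, hmax⟩ := hM
  refine ⟨hMtop, ?_⟩
  intro r t hrt
  by_contra! hcon
  obtain ⟨hr, ht⟩ := hcon
  have hr0 : r ≠ 0 := fun h => hr (h ▸ M.zero_mem)
  have hrK : algebraMap D K r ≠ 0 := by
    simpa using hr0
  let J : Ideal D := Submodule.comap (LinearMap.mulLeft D r) M
  have hmemJ : ∀ x, x ∈ J ↔ r * x ∈ M := fun x => Iff.rfl
  have hMJ : M ≤ J := fun x hx => (hmemJ x).2 (M.mul_mem_left r hx)
  have hJ0 : J ≠ ⊥ := fun h => hM0 (le_bot_iff.1 (h ▸ hMJ))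
  have hJq : J = s.contract J := by
    refine le_antisymm (fun x hx => s.le_star _ (Submodule.mem_map_of_mem hx)) ?_
    intro x hx
    rw [hmemJ, hMq]
    have h1 : algebraMap D K r • Submodule.map (Algebra.linearMap D K) J ≤
        Submodule.map (Algebra.linearMap D K) M := by
      intro z hz
      obtain ⟨w, ⟨j, hj, rfl⟩, rfl⟩ := (Submodule.mem_smul_pointwise_iff_exists _ _ _).1 hz
      exact ⟨r * j, (hmemJ j).1 hj, by simp⟩
    have h2 := s.star_mono _ _ h1
    rw [s.star_smul _ hrK] at h2
    have h3 := h2 (Submodule.smul_mem_pointwise_smul _ (algebraMap D K r) _ hx)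
    refine Submodule.mem_comap.2 ?_
    simpa using h3
  have hJtop : J ≠ ⊤ := by
    intro h
    have : (1 : D) ∈ J := h ▸ Submodule.mem_top
    rw [hmemJ, mul_one] at this
    exact hr this
  exact ht (hmax ⟨⟨hJ0, hJq⟩, hJtop⟩ hMJ ((hmemJ t).2 hrt))

/-- `⋆`-almost Dedekind domain: `D_M` is a discrete valuation ring (of rank one) for each
quasi-`⋆_f`-maximal ideal `M` of `D`. The primality of `M` is automatic by
`IsQuasiMaximal.isPrime`; it is quantified only in order to form the localization. -/
def IsAlmostDedekind [IsDomain D] (s : SemistarOperation D K) : Prop :=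
  ∀ (M : Ideal D) [M.IsPrime], s.finType.IsQuasiMaximal M →
    IsDiscreteValuationRing (Localization.AtPrime M)

end SemistarOperation

/-!
For an ideal `I` of `D`, `x ∈ I D_M` means `u x ∈ I` for some `u ∉ M`, and everything below is
phrased with such multipliers `u`. Because `⋆_f` has finite type, Zorn's lemma places each proper
quasi-`⋆_f`-ideal inside a quasi-`⋆_f`-maximal ideal; so `1 ∈ I^{⋆_f}` as soon as no
quasi-`⋆_f`-maximal ideal contains `I ≠ 0` (`one_mem_contract_finType`), and `y ∈ F^{⋆_f}` as soon
as `y ∈ F D_M` for all quasi-`⋆_f`-maximal `M` (`mem_contract_finType_of_local`). The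
`⋆`-Noetherian condition amounts to every nonzero ideal `I` having a finitely generated `J ⊆ I` with
`I ⊆ J^⋆`.

A `⋆`-Dedekind domain is `⋆`-almost Dedekind: with `J` as above, `x ∈ I` and `G = J + xD`, one has
`G ⊆ J^{⋆_f}`, so invertibility of `G` gives `1 ∈ (J G⁻¹)^{⋆_f}`. Hence some product `f z` with
`f ∈ J`, `z ∈ G⁻¹` lies outside `M`, and `(f z) x = f (z x)` with `z x ∈ D` shows `x ∈ J D_M`. For
`x = 0` this says that `J D_M` is principal, so all ideals of `D_M` are principal.

A `⋆`-Noetherian, `⋆`-almost Dedekind domain has finite character: a quasi-`⋆`-ideal maximal among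
those lying in infinitely many quasi-`⋆_f`-maximal ideals would be prime, but these have height one.

A `⋆`-almost Dedekind domain is a P`⋆`MD, as finitely generated ideals are locally principal, so
that `I I⁻¹` lies in no quasi-`⋆_f`-maximal ideal; and with finite character it is `⋆`-Noetherian,
as finitely many elements suffice to generate `I` at every quasi-`⋆_f`-maximal ideal.
-/

namespace SemistarOperation

/-! ### Ideals that are principal at a prime, up to multipliers outside the prime -/

section Localization

variable {D : Type*} [CommRing D] [IsDomain D]

/-- If `D_M` is a principal ideal ring then `I D_M` is generated by an element of `I`. -/
theorem exists_local_generator (M : Ideal D) [M.IsPrime]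
    [IsPrincipalIdealRing (Localization.AtPrime M)] (I : Ideal D) :
    ∃ a ∈ I, ∀ y ∈ I, ∃ u, u ∉ M ∧ ∃ c, u * y = a * c := by
  obtain ⟨g, hg⟩ := (IsPrincipalIdealRing.principal
    (Ideal.map (algebraMap D (Localization.AtPrime M)) I)).principal
  have hgI : g ∈ Ideal.map (algebraMap D (Localization.AtPrime M)) I := by
    rw [hg]; exact Submodule.mem_span_singleton_self g
  obtain ⟨⟨a, s⟩, has⟩ := (IsLocalization.mem_map_algebraMap_iff M.primeCompl _).1 hgI
  refine ⟨a, a.2, fun y hy => ?_⟩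
  have hy' : algebraMap D (Localization.AtPrime M) y ∈ Submodule.span _ {g} :=
    hg ▸ Ideal.mem_map_of_mem _ hy
  obtain ⟨t, ht⟩ := Submodule.mem_span_singleton.1 hy'
  obtain ⟨⟨b, v⟩, hbv⟩ := IsLocalization.surj M.primeCompl t
  refine ⟨s * v, (s * v).2, b, ?_⟩
  apply IsLocalization.injective (Localization.AtPrime M) M.primeCompl_le_nonZeroDivisors
  simp only [smul_eq_mul] at ht has hbv
  simp only [map_mul, ← has, ← hbv, ← ht]
  ring

/-- For finitely generated `I` a single multiplier outside `M` serves all of `I`. -/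
theorem exists_local_generator_of_fg (M : Ideal D) [M.IsPrime]
    [IsPrincipalIdealRing (Localization.AtPrime M)] {I : Ideal D} (hI : I.FG) :
    ∃ a ∈ I, ∃ u, u ∉ M ∧ ∀ y ∈ I, ∃ c, u * y = a * c := by
  obtain ⟨a, ha, hgen⟩ := exists_local_generator M I
  have key : ∀ J : Ideal D, Submodule.FG J → J ≤ I →
      ∃ u, u ∉ M ∧ ∀ y ∈ J, ∃ c, u * y = a * c := by
    intro J hJ
    induction J, hJ using Submodule.fg_induction with
    | singleton x =>
      intro hxI
      obtain ⟨u, hu, c, hc⟩ := hgen x (hxI (Submodule.mem_span_singleton_self x))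
      refine ⟨u, hu, fun y hy => ?_⟩
      obtain ⟨d, rfl⟩ := Submodule.mem_span_singleton.1 hy
      exact ⟨d * c, by rw [smul_eq_mul]; linear_combination d * hc⟩
    | sup A B _ _ hA hB =>
      intro hAB
      obtain ⟨u, hu, huA⟩ := hA (le_sup_left.trans hAB)
      obtain ⟨v, hv, hvB⟩ := hB (le_sup_right.trans hAB)
      refine ⟨u * v, fun h => (Ideal.IsPrime.mem_or_mem inferInstance h).elim hu hv,
        fun y hy => ?_⟩
      obtain ⟨y₁, h₁, y₂, h₂, rfl⟩ := Submodule.mem_sup.1 hy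
      obtain ⟨c₁, hc₁⟩ := huA y₁ h₁
      obtain ⟨c₂, hc₂⟩ := hvB y₂ h₂
      exact ⟨v * c₁ + u * c₂, by linear_combination v * hc₁ + u * hc₂⟩
  obtain ⟨u, hu, huI⟩ := key I hI le_rfl
  exact ⟨a, ha, u, hu, huI⟩

/-- The converse of `exists_local_generator`, for `M ≠ 0`: local generators of all nonzero ideals of
`D` make every ideal of `D_M` principal. -/
theorem isDiscreteValuationRing_of_exists_local_generator (M : Ideal D) [M.IsPrime] (hM : M ≠ ⊥)
    (h : ∀ I : Ideal D, I ≠ ⊥ → ∃ a ∈ I, ∀ y ∈ I, ∃ u, u ∉ M ∧ ∃ c, u * y = a * c) :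
    IsDiscreteValuationRing (Localization.AtPrime M) := by
  have hpid : IsPrincipalIdealRing (Localization.AtPrime M) := by
    refine ⟨fun J => ?_⟩
    by_cases hI : J.under D = ⊥
    · have hJ := IsLocalization.map_under M.primeCompl (Localization.AtPrime M) J
      rw [hI, Ideal.map_bot] at hJ
      rw [← hJ]
      infer_instance
    obtain ⟨a, ha, hgen⟩ := h _ hI
    refine ⟨algebraMap D _ a, le_antisymm (fun j hj => ?_)
      ((Submodule.span_singleton_le_iff_mem _ _).2 ha)⟩
    obtain ⟨⟨y, s⟩, hys⟩ := IsLocalization.surj M.primeCompl j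
    have hy : y ∈ J.under D := by
      rw [Ideal.under_def, Ideal.mem_comap, ← hys]
      exact J.mul_mem_right _ hj
    obtain ⟨u, hu, c, huc⟩ := hgen y hy
    have hunit := (IsLocalization.map_units (Localization.AtPrime M) (⟨u, hu⟩ : M.primeCompl)).mul
      (IsLocalization.map_units (Localization.AtPrime M) s)
    refine (Ideal.unit_mul_mem_iff_mem _ hunit).1 (Ideal.mem_span_singleton.2
      ⟨algebraMap D _ c, ?_⟩)
    have h1 := congrArg (algebraMap D (Localization.AtPrime M)) huc
    simp only [map_mul] at h1 hys
    rw [← h1, ← hys]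
    ring
  exact
    { hpid with
      not_a_field' := fun h0 => hM <| by
        have hc := IsLocalization.AtPrime.under_maximalIdeal (Localization.AtPrime M) M
        rw [h0] at hc
        rw [← hc, Ideal.under_def, Ideal.comap_bot_of_injective _
          (IsLocalization.injective _ M.primeCompl_le_nonZeroDivisors)] }

/-- If `D_M` is a discrete valuation ring then `M` has height one. -/
theorem eq_of_isPrime_of_le (M : Ideal D) [M.IsPrime]
    [IsDiscreteValuationRing (Localization.AtPrime M)] {P : Ideal D} (hP : P.IsPrime)
    (hP0 : P ≠ ⊥) (hPM : P ≤ M) : P = M := by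
  have hdisj : Disjoint (M.primeCompl : Set D) P :=
    Set.disjoint_left.2 fun x hx hxP => hx (hPM hxP)
  have hprime := IsLocalization.isPrime_of_isPrime_disjoint M.primeCompl
    (Localization.AtPrime M) P hP hdisj
  have hne : Ideal.map (algebraMap D (Localization.AtPrime M)) P ≠ ⊥ := by
    rw [Ne, Ideal.map_eq_bot_iff_of_injective
      (IsLocalization.injective _ M.primeCompl_le_nonZeroDivisors)]
    exact hP0
  have hmax := IsLocalRing.eq_maximalIdeal (hprime.isMaximal hne)
  rw [← IsLocalization.under_map_of_isPrime_disjoint M.primeCompl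
    (Localization.AtPrime M) hP hdisj, hmax,
    IsLocalization.AtPrime.under_maximalIdeal (Localization.AtPrime M) M]

end Localization

/-! ### Quasi-`⋆`-ideals and quasi-`⋆_f`-maximal ideals -/

variable {D K : Type*} [CommRing D] [Field K] [Algebra D K]

theorem mul_star_le (s : SemistarOperation D K) (A B : Submodule D K) :
    s.star A * B ≤ s.star (A * B) := by
  refine Submodule.mul_le.2 fun a ha b hb => ?_
  by_cases hb0 : b = 0
  · simp [hb0]
  have h1 : b • A ≤ A * B := by
    intro z hz
    obtain ⟨w, hw, rfl⟩ := (Submodule.mem_smul_pointwise_iff_exists _ _ _).1 hz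
    rw [smul_eq_mul, mul_comm b w]
    exact Submodule.mul_mem_mul hw hb
  have h2 := s.star_mono _ _ h1
  rw [s.star_smul b hb0] at h2
  have h3 := h2 (Submodule.smul_mem_pointwise_smul a b _ ha)
  rwa [smul_eq_mul, mul_comm b a] at h3

theorem mem_contract {s : SemistarOperation D K} {I : Ideal D} {x : D} :
    x ∈ s.contract I ↔ algebraMap D K x ∈ s.star (Submodule.map (Algebra.linearMap D K) I) :=
  Iff.rfl

theorem le_contract (s : SemistarOperation D K) (I : Ideal D) : I ≤ s.contract I :=
  fun _ hx => s.le_star _ (Submodule.mem_map_of_mem hx)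

theorem map_contract_le (s : SemistarOperation D K) (I : Ideal D) :
    Submodule.map (Algebra.linearMap D K) (s.contract I) ≤
      s.star (Submodule.map (Algebra.linearMap D K) I) :=
  Submodule.map_comap_le _ _

theorem contract_le_of_le {s : SemistarOperation D K} {I J : Ideal D} (h : I ≤ s.contract J) :
    s.contract I ≤ s.contract J := by
  intro x hx
  have h1 := s.star_mono _ _ ((Submodule.map_mono h).trans (s.map_contract_le J))
  rw [s.star_star] at h1
  exact h1 hx

theorem contract_mono (s : SemistarOperation D K) {I J : Ideal D} (h : I ≤ J) :
    s.contract I ≤ s.contract J :=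
  contract_le_of_le (h.trans (s.le_contract J))

theorem isQuasiIdeal_contract (s : SemistarOperation D K) {I : Ideal D} (hI : I ≠ ⊥) :
    s.IsQuasiIdeal (s.contract I) :=
  ⟨fun h => hI (le_bot_iff.1 (h ▸ s.le_contract I)),
    le_antisymm (s.le_contract _) (contract_le_of_le le_rfl)⟩

theorem finType_star_le (s : SemistarOperation D K) (E : Submodule D K) :
    s.finType.star E ≤ s.star E := by
  rintro x ⟨F, -, hFE, hx⟩
  exact s.star_mono _ _ hFE hx

theorem contract_finType_le (s : SemistarOperation D K) (I : Ideal D) :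
    s.finType.contract I ≤ s.contract I :=
  fun _ hx => s.finType_star_le _ hx

theorem contract_le_contract_finType (s : SemistarOperation D K) {I : Ideal D} (hI : I.FG) :
    s.contract I ≤ s.finType.contract I :=
  fun _ hx => ⟨_, Submodule.FG.map _ hI, le_rfl, hx⟩

/-- Since `⋆_f` has finite type, the union of a directed family of quasi-`⋆_f`-ideals is again one. -/
theorem contract_finType_sSup_le (s : SemistarOperation D K) {c : Set (Ideal D)}
    (hne : c.Nonempty) (hc : DirectedOn (· ≤ ·) c) (h : ∀ I ∈ c, I = s.finType.contract I) :
    s.finType.contract (sSup c) ≤ sSup c := by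
  rintro x ⟨F, hF, hFc, hx⟩
  have hmap : Submodule.map (Algebra.linearMap D K) (sSup c) =
      sSup (Submodule.map (Algebra.linearMap D K) '' c) := by
    rw [sSup_image, sSup_eq_iSup, Submodule.map_iSup]
    simp_rw [Submodule.map_iSup]
  obtain ⟨_, ⟨N, hN, rfl⟩, hFN⟩ := (CompleteLattice.isCompactElement_iff_le_of_directed_sSup_le _ _).1
    ((Submodule.fg_iff_compact F).1 hF) _ (hne.image _)
    (hc.mono_comp fun _ _ h => Submodule.map_mono h) (hmap ▸ hFc)
  have hxN : x ∈ s.finType.contract N := ⟨F, hF, hFN, hx⟩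
  rw [← h N hN] at hxN
  exact le_sSup hN hxN

theorem IsQuasiMaximal.one_notMem_star {s : SemistarOperation D K} {M : Ideal D}
    (hM : s.IsQuasiMaximal M) :
    (1 : K) ∉ s.star (Submodule.map (Algebra.linearMap D K) M) := by
  intro h
  refine hM.1.2 ((Ideal.eq_top_iff_one M).2 ?_)
  rw [hM.1.1.2, mem_contract, map_one]
  exact h

/-- If `A B ⊆ D` and `1 ∈ (A B)^⋆` then some product `a b` lies outside a given
quasi-`⋆`-maximal ideal. -/
theorem IsQuasiMaximal.exists_mul_notMem {s : SemistarOperation D K} {M : Ideal D}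
    (hM : s.IsQuasiMaximal M) {A B : Submodule D K} (hAB : A * B ≤ 1)
    (h1 : (1 : K) ∈ s.star (A * B)) :
    ∃ a ∈ A, ∃ b ∈ B, ∃ u, u ∉ M ∧ algebraMap D K u = a * b := by
  by_contra! hcon
  refine hM.one_notMem_star (s.star_mono _ _ (Submodule.mul_le.2 fun a ha b hb => ?_) h1)
  obtain ⟨u, hu⟩ := Submodule.mem_one.1 (hAB (Submodule.mul_mem_mul ha hb))
  refine ⟨u, ?_, hu⟩
  by_contra huM
  exact hcon a ha b hb u huM hu

/-! ### The `⋆`-Noetherian property and finitely generated ideals -/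

/-- Under the `⋆`-Noetherian condition every nonzero ideal has the `⋆`-closure of a finitely generated
subideal, taken so that its quasi-`⋆`-ideal is maximal. -/
theorem IsNoetherianDomain.exists_fg_le_contract {s : SemistarOperation D K}
    (hs : s.IsNoetherianDomain) {I : Ideal D} (hI : I ≠ ⊥) :
    ∃ J : Ideal D, J.FG ∧ J ≠ ⊥ ∧ J ≤ I ∧ I ≤ s.contract J := by
  obtain ⟨x, hx, hx0⟩ := Submodule.exists_mem_ne_zero_of_ne_bot hI
  let T : Set {I : Ideal D // s.IsQuasiIdeal I} :=
    {Q | ∃ J : Ideal D, J.FG ∧ J ≠ ⊥ ∧ J ≤ I ∧ Q.1 = s.contract J}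
  have hx0' : Ideal.span {x} ≠ ⊥ := by simpa using hx0
  have hT : T.Nonempty := ⟨⟨_, s.isQuasiIdeal_contract hx0'⟩, _, Submodule.fg_span_singleton x,
    hx0', (Ideal.span_singleton_le_iff_mem _).2 hx, rfl⟩
  obtain ⟨Q, ⟨J, hJ, hJ0, hJI, hQ⟩, hmax⟩ := hs.wf.has_min T hT
  refine ⟨J, hJ, hJ0, hJI, fun y hy => ?_⟩
  by_contra hyJ
  have hne : J ⊔ Ideal.span {y} ≠ ⊥ := fun h => hJ0 (le_bot_iff.1 (h ▸ le_sup_left))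
  refine hmax ⟨_, s.isQuasiIdeal_contract hne⟩ ⟨_, Submodule.FG.sup hJ (Submodule.fg_span_singleton y), hne,
    sup_le hJI ((Ideal.span_singleton_le_iff_mem _).2 hy), rfl⟩ ?_
  refine lt_of_le_not_ge (a := Q.1) ?_ fun hle => hyJ ?_
  · exact hQ ▸ s.contract_mono le_sup_left
  · rw [← hQ]
    exact hle (s.le_contract _ (Ideal.mem_sup_right (Ideal.mem_span_singleton_self y)))

theorem isNoetherianDomain_of_exists_fg_le_contract {s : SemistarOperation D K}
    (h : ∀ I : Ideal D, I ≠ ⊥ → ∃ J : Ideal D, J.FG ∧ J ≤ I ∧ I ≤ s.contract J) :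
    s.IsNoetherianDomain := by
  rw [IsNoetherianDomain, wellFoundedGT_iff_monotone_chain_condition]
  intro f
  have hmono : Monotone fun n => (f n).1 := fun m n hmn => f.monotone hmn
  obtain ⟨J, hJ, hJI, hIJ⟩ := h (⨆ n, (f n).1)
    (fun h0 => (f 0).2.1 (le_bot_iff.1 (h0 ▸ le_iSup (fun n => (f n).1) 0)))
  obtain ⟨n, hn⟩ : ∃ n, J ≤ (f n).1 := by
    obtain ⟨_, ⟨n, rfl⟩, hn⟩ := (CompleteLattice.isCompactElement_iff_le_of_directed_sSup_le _ _).1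
      ((Submodule.fg_iff_compact J).1 hJ) _ (Set.range_nonempty fun n => (f n).1)
      (directedOn_range.2 hmono.directed_le) hJI
    exact ⟨n, hn⟩
  refine ⟨n, fun m hnm => le_antisymm (f.monotone hnm) ?_⟩
  calc (f m).1 ≤ ⨆ n, (f n).1 := le_iSup (fun n => (f n).1) m
    _ ≤ s.contract J := hIJ
    _ ≤ s.contract (f n).1 := s.contract_mono hn
    _ = (f n).1 := (f n).2.2.symm

/-! ### Testing membership at the quasi-`⋆_f`-maximal ideals -/

theorem exists_isQuasiMaximal_finType_of_le (s : SemistarOperation D K) {I : Ideal D}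
    (hI : s.finType.IsQuasiIdeal I) (hI1 : I ≠ ⊤) :
    ∃ M, s.finType.IsQuasiMaximal M ∧ I ≤ M := by
  have hub : ∀ c ⊆ {I : Ideal D | s.finType.IsQuasiIdeal I ∧ I ≠ ⊤}, IsChain (· ≤ ·) c →
      ∀ J ∈ c, ∃ U ∈ {I : Ideal D | s.finType.IsQuasiIdeal I ∧ I ≠ ⊤}, ∀ z ∈ c, z ≤ U := by
    intro c hc hchain J hJ
    refine ⟨sSup c, ⟨⟨fun h => (hc hJ).1.1 (le_bot_iff.1 (h ▸ le_sSup hJ)),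
      le_antisymm (le_contract _ _) (s.contract_finType_sSup_le ⟨J, hJ⟩ hchain.directedOn
        fun I hI => (hc hI).1.2)⟩, fun h => ?_⟩, fun _ h => le_sSup h⟩
    have h1 : (1 : D) ∈ sSup c := h ▸ Submodule.mem_top
    obtain ⟨N, hN, h1N⟩ := (Submodule.mem_sSup_of_directed ⟨J, hJ⟩ hchain.directedOn).1 h1
    exact (hc hN).2 ((Ideal.eq_top_iff_one _).2 h1N)
  obtain ⟨M, hIM, hM⟩ := zorn_le_nonempty₀ _ hub I ⟨hI, hI1⟩
  exact ⟨M, hM, hIM⟩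

/-- If no quasi-`⋆_f`-maximal ideal contains the nonzero ideal `I`, then `1 ∈ I^{⋆_f}`. -/
theorem one_mem_contract_finType (s : SemistarOperation D K) {I : Ideal D} (hI : I ≠ ⊥)
    (h : ∀ M, s.finType.IsQuasiMaximal M → ∃ u ∈ I, u ∉ M) : 1 ∈ s.finType.contract I := by
  by_contra hcon
  obtain ⟨M, hM, hIM⟩ := s.exists_isQuasiMaximal_finType_of_le (s.finType.isQuasiIdeal_contract hI)
    (fun h1 => hcon (h1 ▸ Submodule.mem_top))
  obtain ⟨u, hu, huM⟩ := h M hM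
  exact huM (hIM (s.finType.le_contract I hu))

/-- `⋆_f`-membership can be tested at the quasi-`⋆_f`-maximal ideals: if `y ∈ F D_M` for all of
them then `y ∈ F^{⋆_f}`. -/
theorem mem_contract_finType_of_local (s : SemistarOperation D K) {F : Ideal D} (hF : F ≠ ⊥)
    {y : D} (h : ∀ M, s.finType.IsQuasiMaximal M → ∃ u, u ∉ M ∧ u * y ∈ F) :
    y ∈ s.finType.contract F := by
  let C : Ideal D := Submodule.comap (LinearMap.mulLeft D y) F
  have hmem : ∀ x, x ∈ C ↔ y * x ∈ F := fun x => Iff.rfl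
  have hFC : F ≤ C := fun x hx => (hmem x).2 (F.mul_mem_left y hx)
  have h1 : 1 ∈ s.finType.contract C :=
    s.one_mem_contract_finType (fun h0 => hF (le_bot_iff.1 (h0 ▸ hFC))) fun M hM => by
      obtain ⟨u, hu, huF⟩ := h M hM
      exact ⟨u, (hmem u).2 (mul_comm u y ▸ huF), hu⟩
  have hle : Submodule.map (Algebra.linearMap D K) C * Submodule.span D {algebraMap D K y} ≤
      Submodule.map (Algebra.linearMap D K) F := by
    refine Submodule.mul_le.2 ?_
    rintro _ ⟨c, hc, rfl⟩ z hz
    obtain ⟨d, rfl⟩ := Submodule.mem_span_singleton.1 hz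
    exact ⟨d * (y * c), F.mul_mem_left d hc, by simp [Algebra.smul_def]; ring⟩
  have h2 := s.finType.star_mono _ _ hle (s.finType.mul_star_le _ _
    (Submodule.mul_mem_mul (mem_contract.1 h1) (Submodule.mem_span_singleton_self _)))
  rw [mem_contract]
  simpa using h2

/-! ### The three conditions -/

variable [IsDomain D] [IsFractionRing D K]

/-- If `I ⊆ J^⋆` with `J ⊆ I` finitely generated, then `⋆_f`-invertibility of `J` makes `J D_M`
principal, and that of `J + xD` for `x ∈ I` gives `x ∈ J D_M`. Hence every ideal of `D_M` is
principal. -/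
theorem IsDedekind.isAlmostDedekind {s : SemistarOperation D K} (hs : s.IsDedekind) :
    s.IsAlmostDedekind := by
  intro M _ hM
  refine isDiscreteValuationRing_of_exists_local_generator M hM.1.1.1 fun I hI => ?_
  obtain ⟨J, hJ, hJ0, hJI, hIJ⟩ := hs.1.exists_fg_le_contract hI
  have hdiv : ∀ {E : Submodule D K} {z w : K}, z ∈ 1 / E → w ∈ E →
      ∃ d, algebraMap D K d = z * w :=
    fun hz hw => Submodule.mem_one.1 (Submodule.mem_div_iff_forall_mul_mem.1 hz _ hw)
  have hone : (1 : K) ∈ s.finType.star 1 := s.finType.le_star _ (Submodule.one_le.1 le_rfl)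
  -- Any `y ∈ J^⋆` lies in `f D_M` for some `f ∈ J`.
  have key : ∀ y ∈ s.contract J, ∃ f ∈ J, ∃ z ∈ 1 / Submodule.map (Algebra.linearMap D K)
      (J ⊔ Ideal.span {y}), ∃ u, u ∉ M ∧ algebraMap D K u = algebraMap D K f * z := by
    intro y hy
    have hne : J ⊔ Ideal.span {y} ≠ ⊥ := fun h => hJ0 (le_bot_iff.1 (h ▸ le_sup_left))
    have hinv := hs.2 _ hne (Submodule.FG.sup hJ (Submodule.fg_span_singleton y))
    set G := Submodule.map (Algebra.linearMap D K) (J ⊔ Ideal.span {y}) with hG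
    set E := Submodule.map (Algebra.linearMap D K) J with hE
    have hEG : E ≤ G := Submodule.map_mono le_sup_left
    have hGE : G ≤ s.finType.star E := by
      refine (Submodule.map_mono ?_).trans (s.finType.map_contract_le J)
      exact sup_le (le_contract _ _) ((Ideal.span_singleton_le_iff_mem _).2
        (s.contract_le_contract_finType hJ hy))
    have h1 : (1 : K) ∈ s.finType.star (E * (1 / G)) := by
      have h2 : G * (1 / G) ≤ s.finType.star (E * (1 / G)) :=
        (mul_le_mul' hGE le_rfl).trans (s.finType.mul_star_le _ _)
      have h3 := s.finType.star_mono _ _ h2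
      rw [s.finType.star_star, hinv] at h3
      exact h3 hone
    obtain ⟨_, ⟨f, hf, rfl⟩, z, hz, u, hu, huz⟩ := hM.exists_mul_notMem
      ((mul_le_mul' hEG le_rfl).trans Submodule.mul_one_div_le_one) h1
    exact ⟨f, hf, z, hz, u, hu, huz⟩
  obtain ⟨j, hj, z, hz, u, hu, huz⟩ := key 0 (zero_mem _)
  refine ⟨j, hJI hj, fun x hx => ?_⟩
  obtain ⟨f, hf, w, hw, v, hv, hvw⟩ := key x (hIJ hx)
  obtain ⟨b, hb⟩ := hdiv hz (Submodule.mem_map_of_mem (Ideal.mem_sup_left hf))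
  obtain ⟨c, hc⟩ := hdiv hw (Submodule.mem_map_of_mem
    (Ideal.mem_sup_right (Ideal.mem_span_singleton_self x)))
  refine ⟨u * v, fun h => (Ideal.IsPrime.mem_or_mem inferInstance h).elim hu hv, b * c, ?_⟩
  apply IsFractionRing.injective D K
  simp only [Algebra.linearMap_apply] at hb hc
  simp only [map_mul, huz, hvw, hb, hc]
  ring

theorem IsAlmostDedekind.isPruferMultiplicationDomain {s : SemistarOperation D K}
    (hs : s.IsAlmostDedekind) : s.IsPruferMultiplicationDomain := by
  intro I hI hfg
  set E := Submodule.map (Algebra.linearMap D K) I with hE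
  have hle : E * (1 / E) ≤ 1 := Submodule.mul_one_div_le_one
  refine le_antisymm (s.finType.star_mono _ _ hle) ?_
  let A : Ideal D := Submodule.comap (Algebra.linearMap D K) (E * (1 / E))
  have hmem : ∀ {a u : D}, a ∈ I → a ≠ 0 → (∀ y ∈ I, ∃ c, u * y = a * c) → u ∈ A := by
    intro a u ha ha0 hu
    have ha0' : algebraMap D K a ≠ 0 := by simpa using ha0
    have h1 : (algebraMap D K a)⁻¹ * algebraMap D K u ∈ 1 / E := by
      refine Submodule.mem_div_iff_forall_mul_mem.2 ?_
      rintro _ ⟨y, hy, rfl⟩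
      obtain ⟨c, hc⟩ := hu y hy
      refine Submodule.mem_one.2 ⟨c, ?_⟩
      rw [Algebra.linearMap_apply, mul_assoc, ← map_mul, hc, map_mul,
        inv_mul_cancel_left₀ ha0']
    have h2 : algebraMap D K a * _ ∈ E * (1 / E) :=
      Submodule.mul_mem_mul (Submodule.mem_map_of_mem ha) h1
    rwa [mul_inv_cancel_left₀ ha0'] at h2
  obtain ⟨x, hx, hx0⟩ := Submodule.exists_mem_ne_zero_of_ne_bot hI
  have hA : A ≠ ⊥ := fun h => hx0 <| by
    have hxA := hmem hx hx0 (u := x) fun y _ => ⟨y, rfl⟩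
    rw [h] at hxA
    exact hxA
  have h1 : 1 ∈ s.finType.contract A := by
    refine s.one_mem_contract_finType hA fun M hM => ?_
    have := hM.isPrime
    have := hs M hM
    obtain ⟨a, ha, u, hu, huI⟩ := exists_local_generator_of_fg M hfg
    refine ⟨u, hmem ha ?_ huI, hu⟩
    rintro rfl
    obtain ⟨c, hc⟩ := huI x hx
    have : u * x = 0 := by simpa using hc
    rcases mul_eq_zero.1 this with h | h
    · exact hu (h ▸ M.zero_mem)
    · exact hx0 h
  have h2 : (1 : K) ∈ s.finType.star (E * (1 / E)) := by
    have := s.finType.star_mono _ _ (Submodule.map_comap_le _ _) (mem_contract.1 h1)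
    simpa using this
  rw [← s.finType.star_star (E * (1 / E))]
  exact s.finType.star_mono _ _ (Submodule.one_le.2 h2)

/-- Noetherian induction on quasi-`⋆`-ideals: an ideal maximal among those contained in infinitely
many quasi-`⋆_f`-maximal ideals would be prime, hence equal to each of these because they have
height one. -/
theorem IsNoetherianDomain.hasFiniteCharacter {s : SemistarOperation D K}
    (hs : s.IsNoetherianDomain) (hD : s.IsAlmostDedekind) : s.finType.HasFiniteCharacter := by
  have hcontract : ∀ I : Ideal D, I ≠ ⊥ → s.contract I ≤ s.finType.contract I := by
    intro I hI
    obtain ⟨J, hJ, -, hJI, hIJ⟩ := hs.exists_fg_le_contract hI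
    exact (contract_le_of_le hIJ).trans ((s.contract_le_contract_finType hJ).trans
      (s.finType.contract_mono hJI))
  have hle : ∀ {I M : Ideal D}, I ≠ ⊥ → s.finType.IsQuasiMaximal M → I ≤ M →
      s.contract I ≤ M := by
    intro I M hI hM hIM
    rw [hM.1.1.2]
    exact (hcontract I hI).trans (s.finType.contract_mono hIM)
  have main : ∀ Q : {I : Ideal D // s.IsQuasiIdeal I},
      {M : Ideal D | s.finType.IsQuasiMaximal M ∧ Q.1 ≤ M}.Finite := by
    intro Q
    induction Q using hs.wf.induction with
    | h Q ih =>
    have hsup : ∀ a ∉ Q.1, {M : Ideal D | s.finType.IsQuasiMaximal M ∧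
        Q.1 ≤ M ∧ a ∈ M}.Finite := by
      intro a ha
      have hne : Q.1 ⊔ Ideal.span {a} ≠ ⊥ := fun h => Q.2.1 (le_bot_iff.1 (h ▸ le_sup_left))
      refine (ih ⟨_, s.isQuasiIdeal_contract hne⟩ ?_).subset ?_
      · exact lt_of_le_not_ge (a := Q.1) (le_sup_left.trans (s.le_contract _)) fun h =>
          ha (h (s.le_contract _ (Ideal.mem_sup_right (Ideal.mem_span_singleton_self a))))
      · rintro M ⟨hM, hQM, haM⟩
        exact ⟨hM, hle hne hM (sup_le hQM ((Ideal.span_singleton_le_iff_mem _).2 haM))⟩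
    by_cases hQ : Q.1.IsPrime
    · refine (Set.finite_singleton Q.1).subset ?_
      rintro M ⟨hM, hQM⟩
      have := hM.isPrime
      have := hD M hM
      exact (eq_of_isPrime_of_le M hQ Q.2.1 hQM).symm
    · by_cases htop : Q.1 = ⊤
      · refine Set.finite_empty.subset ?_
        rintro M ⟨hM, hQM⟩
        exact hM.1.2 (top_le_iff.1 (htop ▸ hQM))
      · obtain ⟨a, ha, b, hb, hab⟩ := (Ideal.not_isPrime_iff.1 hQ).resolve_left htop
        refine ((hsup a ha).union (hsup b hb)).subset ?_
        rintro M ⟨hM, hQM⟩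
        exact (hM.isPrime.mem_or_mem (hQM hab)).imp (fun h => ⟨hM, hQM, h⟩)
          (fun h => ⟨hM, hQM, h⟩)
  intro x hx
  have hne : Ideal.span {x} ≠ ⊥ := by simpa using hx
  refine (main ⟨_, s.isQuasiIdeal_contract hne⟩).subset ?_
  rintro M ⟨hM, hxM⟩
  exact ⟨hM, hle hne hM ((Ideal.span_singleton_le_iff_mem _).2 hxM)⟩

/-- For `0 ≠ x ∈ I`, the ideal generated by `x` and by local generators of `I` at the finitely many
quasi-`⋆_f`-maximal ideals containing `x` has the same localizations as `I` at all
quasi-`⋆_f`-maximal ideals. -/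
theorem IsAlmostDedekind.isNoetherianDomain {s : SemistarOperation D K}
    (hs : s.IsAlmostDedekind) (hfin : s.finType.HasFiniteCharacter) : s.IsNoetherianDomain := by
  refine isNoetherianDomain_of_exists_fg_le_contract fun I hI => ?_
  obtain ⟨x, hx, hx0⟩ := Submodule.exists_mem_ne_zero_of_ne_bot hI
  have hgen : ∀ M : Ideal D, ∃ a ∈ I, s.finType.IsQuasiMaximal M →
      ∀ y ∈ I, ∃ u, u ∉ M ∧ ∃ c, u * y = a * c := by
    intro M
    by_cases hM : s.finType.IsQuasiMaximal M
    · have := hM.isPrime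
      have := hs M hM
      obtain ⟨a, ha, h⟩ := exists_local_generator M I
      exact ⟨a, ha, fun _ => h⟩
    · exact ⟨x, hx, fun h => absurd h hM⟩
  choose a haI ha using hgen
  let T : Set D := insert x (a '' {M | s.finType.IsQuasiMaximal M ∧ x ∈ M})
  have hT : T.Finite := ((hfin x hx0).image a).insert x
  have hxT : x ∈ Ideal.span T := Ideal.subset_span (Set.mem_insert _ _)
  refine ⟨Ideal.span T, Submodule.fg_span hT, Ideal.span_le.2 ?_, fun y hy => ?_⟩
  · rintro t (rfl | ⟨M, -, rfl⟩)
    · exact hx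
    · exact haI M
  refine s.contract_finType_le _ (s.mem_contract_finType_of_local
    (fun h => hx0 (by rw [h] at hxT; exact hxT)) fun M hM => ?_)
  by_cases hxM : x ∈ M
  · obtain ⟨u, hu, c, hc⟩ := ha M hM y hy
    refine ⟨u, hu, hc ▸ Ideal.mul_mem_right _ _ (Ideal.subset_span ?_)⟩
    exact Set.mem_insert_of_mem _ ⟨M, ⟨hM, hxM⟩, rfl⟩
  · exact ⟨x, hxM, Ideal.mul_mem_right _ _ hxT⟩

end SemistarOperation

theorem theorem4p12 {D K : Type*} [CommRing D] [IsDomain D] [Field K] [Algebra D K]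
    [IsFractionRing D K] (s : SemistarOperation D K) :
    List.TFAE
      [ s.IsDedekind,
        s.IsAlmostDedekind ∧ s.finType.HasFiniteCharacter,
        s.IsNoetherianDomain ∧ s.IsAlmostDedekind ] := by
  tfae_have 1 → 3 := fun h => ⟨h.1, h.isAlmostDedekind⟩
  tfae_have 3 → 2 := fun h => ⟨h.2, h.1.hasFiniteCharacter h.2⟩
  tfae_have 2 → 1 := fun h => ⟨h.1.isNoetherianDomain h.2, h.1.isPruferMultiplicationDomain⟩
  tfae_finish
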